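/- Let $\alpha>0$, $\delta>0$ and let $s\ge 2$ be an integer. For every integer $k\ge 1$ put $n=k(s+1)-1$, let $X_1,\dots,X_n$ be independent random variables with the Pareto$(\alpha,\delta)$ distribution, i.e. with distribution function $F(x)=1-(\delta/x)^{\alpha}$ for $x>\delta$ and $F(x)=0$ for $x\le\delta$, and let $X_{(1,n)}\le\dots\le X_{(n,n)}$ be their increasing order statistics. Let $H_m=\sum_{j=1}^m \frac1j$ (with $H_0=0$) and $$L_{k,s}=\log\frac{X_{(ks,n)}}{X_{(k,n)}},\qquad Q_{k,s}=\frac{L_{k,s}}{H_{ks-1}-H_{k-1}},\qquad Q^*_{k,s}=\frac{L_{k,s}}{\log s}.$$ Then, in distribution as $k\to\infty$, $$\sqrt{n}\left[L_{k,s}-\frac{\log s}{\alpha}\right]\to N\!\left(0,\frac{s^2-1}{s\alpha^2}\right),$$ $$\sqrt{n}\,(H_{ks-1}-H_{k-1})\left[\alpha Q_{k,s}-\frac{\log s}{H_{ks-1}-H_{k-1}}\right]\to N\!\left(0,\frac{s^2-1}{s}\right),$$ $$\sqrt{n}\left[\alpha Q^*_{k,s}-1\right]\to N\!\left(0,\frac{s^2-1}{s(\log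 s)^2}\right).$$ Consequently, for every $\alpha_0\in(0,1)$, with $z_{1-\alpha_0/2}$ the $(1-\alpha_0/2)$-quantile of the standard normal distribution, $$P\left[\frac{\log s}{L_{k,s}}-\frac{z_{1-\alpha_0/2}}{L_{k,s}}\sqrt{\frac{s^2-1}{sn}}\le\alpha\le\frac{\log s}{L_{k,s}}+\frac{z_{1-\alpha_0/2}}{L_{k,s}}\sqrt{\frac{s^2-1}{sn}}\right]\to 1-\alpha_0\qquad(k\to\infty).$$ -/

import Mathlib

noncomputable section

namespace ParetoOrder

/-- The `i`-th smallest value `x_(i,n)` of `x₁, …, xₙ`, for `1 ≤ i ≤ n` (the value for other `i` is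
a dummy `0`). -/
def orderStat {n : ℕ} (x : Fin n → ℝ) (i : ℕ) : ℝ :=
  if h : 1 ≤ i ∧ i ≤ n then x (Tuple.sort x ⟨i - 1, by omega⟩) else 0

/-- `log (x_(ks,n) / x_(k,n))` for a sample of size `n = k(s+1) - 1`. -/
def logRatio (k s : ℕ) (x : Fin (k * (s + 1) - 1) → ℝ) : ℝ :=
  Real.log (orderStat x (k * s) / orderStat x k)

/-- `H_{ks-1} - H_{k-1}`, a difference of harmonic numbers. -/
def harmonicDiff (k s : ℕ) : ℝ := (harmonic (k * s - 1) : ℝ) - (harmonic (k - 1) : ℝ)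

/-- The statistic `Q_{k,s}`. -/
def Q (k s : ℕ) (x : Fin (k * (s + 1) - 1) → ℝ) : ℝ := logRatio k s x / harmonicDiff k s

/-- The statistic `Q*_{k,s}`. -/
def QStar (k s : ℕ) (x : Fin (k * (s + 1) - 1) → ℝ) : ℝ := logRatio k s x / Real.log s

/-- The `p`-quantile of the standard normal distribution. -/
def normalQuantile (p : ℝ) : ℝ :=
  sInf {z : ℝ | p ≤ ProbabilityTheory.cdf (ProbabilityTheory.gaussianReal 0 1) z}

/-- The confidence interval for the shape parameter at level `1 - a`, computed from a sample `x`. -/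
def confInterval (k s : ℕ) (a : ℝ) (x : Fin (k * (s + 1) - 1) → ℝ) : Set ℝ :=
  Set.Icc
    (Real.log s / logRatio k s x - normalQuantile (1 - a / 2) / logRatio k s x *
      √(((s : ℝ) ^ 2 - 1) / (s * (k * (s + 1) - 1))))
    (Real.log s / logRatio k s x + normalQuantile (1 - a / 2) / logRatio k s x *
      √(((s : ℝ) ^ 2 - 1) / (s * (k * (s + 1) - 1))))

end ParetoOrder

end

/-! If `X` is Pareto then `α * log (X / δ)` is standard exponential (`map_log_paretoMeasure`), and
an increasing map commutes with order statistics. So `α L` is the spacing between the `k`-th and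
`ks`-th order statistics of `n` standard exponentials.

By memorylessness, removing the minimum of an exponential sample leaves exceedances that are again
i.i.d. exponential and independent of it (`lintegral_pi_expMeasure_eq_minimum`). Iterating gives
Rényi's representation: the spacing is distributed as a sum of independent exponentials with rates
`k, …, ks - 1`, used here through its characteristic function `∏ (1 - it/(k+j))⁻¹`
(`charFun_map_mul_logRatio`).

Expanding the logarithm of this product at `√n t` to second order, the linear term is `√n (H_{ks-1}
- H_{k-1})`, which differs from `√n log s` by `o(1)`; the quadratic term gives the variance `lim n ∑
1/(k+j)² = (s+1)(1 - 1/s)`; the cubic remainder vanishes (`tendsto_exp_mul_prod`). Lévy's continuity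
theorem yields the normal limit of `c √n (α L - log s)`. The three limit laws are this one for
different `c`, and coverage follows from the portmanteau theorem with `c` chosen to make the
variance 1. -/

namespace ParetoOrder

open Function

/-! ### Order statistics of a finite real sample -/

section OrderStat

variable {n : ℕ}

/-- An order statistic can be read off from any permutation that sorts the sample. -/
lemma orderStat_eq_of_monotone (x : Fin n → ℝ) (σ : Equiv.Perm (Fin n)) (hσ : Monotone (x ∘ σ))
    {i : ℕ} (h : 1 ≤ i ∧ i ≤ n) : orderStat x i = x (σ ⟨i - 1, by omega⟩) := by
  have := congrFun (Tuple.comp_sort_eq_comp_iff_monotone.2 hσ) ⟨i - 1, by omega⟩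
  simpa [orderStat, h] using this.symm

-- The dummy value at index 0 serves as the origin from which the first spacing is measured, so the
-- inductions on the index below can start at 0.
@[simp]
lemma orderStat_zero (x : Fin n → ℝ) : orderStat x 0 = 0 := by simp [orderStat]

lemma orderStat_comp_perm (x : Fin n → ℝ) (σ : Equiv.Perm (Fin n)) (i : ℕ) :
    orderStat (x ∘ σ) i = orderStat x i := by
  unfold orderStat
  split_ifs with h
  · exact congrFun (Tuple.comp_perm_comp_sort_eq_comp_sort (f := x) (σ := σ)) ⟨i - 1, by omega⟩
  · rfl

lemma orderStat_mem_range (x : Fin n → ℝ) {i : ℕ} (h : 1 ≤ i ∧ i ≤ n) :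
    orderStat x i ∈ Set.range x := by
  simp [orderStat, h]

lemma orderStat_comp_of_monotoneOn (x : Fin n → ℝ) {g : ℝ → ℝ} (hg : MonotoneOn g (Set.range x))
    {i : ℕ} (h : 1 ≤ i ∧ i ≤ n) : orderStat (g ∘ x) i = g (orderStat x i) := by
  rw [orderStat_eq_of_monotone (g ∘ x) (Tuple.sort x) _ h]
  · simp [orderStat, h]
  · intro a b hab
    exact hg ⟨_, rfl⟩ ⟨_, rfl⟩ (Tuple.monotone_sort x hab)

lemma orderStat_le_orderStat (x : Fin n → ℝ) {i j : ℕ} (hi : 1 ≤ i) (hij : i ≤ j) (hj : j ≤ n) :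
    orderStat x i ≤ orderStat x j := by
  have h1 : 1 ≤ i ∧ i ≤ n := by omega
  have h2 : 1 ≤ j ∧ j ≤ n := by omega
  simp only [orderStat, h1, h2, and_self, dite_true]
  exact Tuple.monotone_sort x (by simp only [Fin.mk_le_mk]; omega)

/-- Prepending a lower bound of the sample shifts its order statistics by one index. -/
lemma orderStat_cons_add (v : ℝ) (y : Fin n → ℝ) (hy : ∀ j, 0 ≤ y j) {i : ℕ} (hi : i ≤ n) :
    orderStat (Fin.cons v (fun j => v + y j) : Fin (n + 1) → ℝ) (i + 1) = v + orderStat y i := by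
  set x : Fin (n + 1) → ℝ := Fin.cons v (fun j => v + y j) with hx
  let σ : Equiv.Perm (Fin (n + 1)) := Equiv.Perm.decomposeFin.symm (0, Tuple.sort y)
  have hσ0 : σ 0 = 0 := by simp [σ]
  have hσs (j : Fin n) : σ j.succ = (Tuple.sort y j).succ := by
    simp [σ]
  have hmono : Monotone (x ∘ σ) := by
    intro a b hab
    induction a using Fin.cases with
    | zero =>
      induction b using Fin.cases with
      | zero => exact le_rfl
      | succ b => simp [hσ0, hσs, hx, hy]
    | succ a =>
      induction b using Fin.cases with
      | zero => simp at hab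
      | succ b =>
        have := Tuple.monotone_sort y (Fin.succ_le_succ_iff.1 hab)
        simpa [hσs, hx] using this
  rw [orderStat_eq_of_monotone x σ hmono ⟨by omega, by omega⟩]
  rcases i with _ | i
  · have : (⟨0 + 1 - 1, by omega⟩ : Fin (n + 1)) = 0 := rfl
    rw [this, hσ0]
    simp [hx]
  · have : (⟨i + 1 + 1 - 1, by omega⟩ : Fin (n + 1)) = Fin.succ ⟨i, by omega⟩ := rfl
    rw [this, hσs]
    simp [hx, orderStat, hi]

-- The sorting permutation depends on the sample, but only finitely many are possible; where a given
-- one sorts, the order statistic is a coordinate.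
@[fun_prop]
lemma measurable_orderStat (i : ℕ) : Measurable (fun x : Fin n → ℝ => orderStat x i) := by
  by_cases h : 1 ≤ i ∧ i ≤ n
  · refine measurable_of_Iic fun t => ?_
    have : (fun x : Fin n → ℝ => orderStat x i) ⁻¹' Set.Iic t = ⋃ σ : Equiv.Perm (Fin n),
        ({x | Monotone (x ∘ σ)} ∩ {x | x (σ ⟨i - 1, by omega⟩) ≤ t}) := by
      ext x
      simp only [Set.mem_preimage, Set.mem_Iic, Set.mem_iUnion, Set.mem_inter_iff, Set.mem_ofPred_eq]
      constructor
      · intro hx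
        exact ⟨Tuple.sort x, Tuple.monotone_sort x, by simpa [orderStat, h] using hx⟩
      · rintro ⟨σ, hσ, hx⟩
        rwa [orderStat_eq_of_monotone x σ hσ h]
    rw [this]
    refine MeasurableSet.iUnion fun σ => MeasurableSet.inter ?_ ?_
    · simp only [Monotone, Set.ofPred_forall, comp_apply]
      exact MeasurableSet.iInter fun a => MeasurableSet.iInter fun b => MeasurableSet.iInter fun _ =>
        measurableSet_le (by fun_prop) (by fun_prop)
    · exact measurableSet_le (by fun_prop) (by fun_prop)
  · simp [orderStat, h]

end OrderStat

end ParetoOrder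

namespace ParetoOrder

open MeasureTheory ProbabilityTheory
open scoped ENNReal

/-! ### Conditioning an i.i.d. sample on its minimum -/

section Minimum

variable {n : ℕ}

/-- The samples whose first minimal entry has index `i`. -/
def argminSet (i : Fin (n + 1)) : Set (Fin (n + 1) → ℝ) :=
  {x | ∀ j, (j < i → x i < x j) ∧ (i < j → x i ≤ x j)}

lemma measurableSet_argminSet (i : Fin (n + 1)) : MeasurableSet (argminSet i) := by
  have : argminSet i = ⋂ j, ({x | j < i → x i < x j} ∩ {x | i < j → x i ≤ x j}) := by
    ext x; simp [argminSet]
  rw [this]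
  refine MeasurableSet.iInter fun j => MeasurableSet.inter ?_ ?_
  · by_cases h : j < i
    · simpa [h] using measurableSet_lt (by fun_prop) (by fun_prop)
    · simp [h]
  · by_cases h : i < j
    · simpa [h] using measurableSet_le (by fun_prop) (by fun_prop)
    · simp [h]

lemma pairwise_disjoint_argminSet :
    Pairwise (Function.onFun Disjoint (argminSet : Fin (n + 1) → Set (Fin (n + 1) → ℝ))) := by
  have key (i j : Fin (n + 1)) (h : i < j) : Disjoint (argminSet i) (argminSet j) := by
    rw [Set.disjoint_left]
    intro x hi hj
    exact absurd ((hi j).2 h) (not_le.2 ((hj i).1 h))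
  intro i j hij
  rcases lt_or_gt_of_ne hij with h | h
  · exact key i j h
  · exact (key j i h).symm

lemma iUnion_argminSet : ⋃ i, (argminSet i : Set (Fin (n + 1) → ℝ)) = Set.univ := by
  refine Set.eq_univ_of_forall fun x => Set.mem_iUnion.2 ?_
  -- Minimizing lexicographically in (value, index) selects the first minimal entry.
  obtain ⟨i, -, hi⟩ := Finset.exists_min_image Finset.univ (fun i => toLex (x i, i))
    Finset.univ_nonempty
  refine ⟨i, fun j => ?_⟩
  have := hi j (Finset.mem_univ j)
  rw [Prod.Lex.toLex_le_toLex] at this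
  simp only at this
  constructor
  · intro h
    rcases this with h' | h'
    · exact h'
    · exact absurd h'.2 (not_le.2 h)
  · intro h
    rcases this with h' | h'
    · exact h'.le
    · exact h'.1.le

lemma insertNth_mem_argminSet (i : Fin (n + 1)) (v : ℝ) (y : Fin n → ℝ) :
    (i.insertNth v y : Fin (n + 1) → ℝ) ∈ argminSet i ↔
      y ∈ Set.univ.pi fun j => if i.succAbove j < i then Set.Ioi v else Set.Ici v := by
  simp only [argminSet, Set.mem_ofPred_eq, Fin.forall_iff_succAbove i, Fin.insertNth_apply_same,
    Fin.insertNth_apply_succAbove, Set.mem_pi, Set.mem_univ, true_imp_iff, lt_self_iff_false,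
    false_imp_iff, and_self, true_and]
  refine forall_congr' fun j => ?_
  have hne := i.succAbove_ne j
  by_cases h : i.succAbove j < i
  · simp [h, not_lt.2 h.le]
  · have hgt : i < i.succAbove j := lt_of_le_of_ne (not_lt.1 h) hne.symm
    simp [h, hgt]

/-- Integration of a symmetric function of an i.i.d. sample, by conditioning on the minimum. -/
lemma lintegral_pi_eq_minimum (μ : Measure ℝ) [SigmaFinite μ] [NullSingletonClass μ]
    {F : (Fin (n + 1) → ℝ) → ℝ≥0∞} (hF : Measurable F)
    (hsymm : ∀ x (σ : Equiv.Perm (Fin (n + 1))), F (x ∘ σ) = F x) :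
    ∫⁻ x, F x ∂Measure.pi (fun _ => μ) = (n + 1) *
      ∫⁻ v, ∫⁻ y in Set.univ.pi (fun _ => Set.Ici v), F (Fin.cons v y)
        ∂Measure.pi (fun _ : Fin n => μ) ∂μ := by
  rw [← setLIntegral_univ, ← iUnion_argminSet,
    lintegral_iUnion measurableSet_argminSet pairwise_disjoint_argminSet, tsum_fintype]
  -- All `n + 1` cells contribute equally: a cyclic permutation moves entry `i` to the front without
  -- changing `F`, and absence of atoms makes the open and closed sides of the box interchangeable.
  have key (i : Fin (n + 1)) : ∫⁻ x in argminSet i, F x ∂Measure.pi (fun _ => μ) =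
      ∫⁻ v, ∫⁻ y in Set.univ.pi (fun _ => Set.Ici v), F (Fin.cons v y)
        ∂Measure.pi (fun _ : Fin n => μ) ∂μ := by
    have hG : Measurable ((argminSet i).indicator F) := hF.indicator (measurableSet_argminSet i)
    rw [← lintegral_indicator (measurableSet_argminSet i),
      ← ((measurePreserving_piFinSuccAbove (fun _ => μ) i).symm).lintegral_comp hG,
      lintegral_prod _ (by fun_prop)]
    refine lintegral_congr fun v => ?_
    have h1 (y : Fin n → ℝ) : (argminSet i).indicator F
        ((MeasurableEquiv.piFinSuccAbove (fun _ => ℝ) i).symm (v, y)) =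
        (Set.univ.pi fun j => if i.succAbove j < i then Set.Ioi v else Set.Ici v).indicator
          (fun y => F (Fin.cons v y)) y := by
      have h2 : (MeasurableEquiv.piFinSuccAbove (fun _ => ℝ) i).symm (v, y) =
        (i.insertNth v y : Fin (n + 1) → ℝ) := rfl
      rw [h2]
      by_cases h : (i.insertNth v y : Fin (n + 1) → ℝ) ∈ argminSet i
      · rw [Set.indicator_of_mem h, Set.indicator_of_mem ((insertNth_mem_argminSet i v y).1 h),
          ← Fin.insertNth_comp_cycleRange_symm i, hsymm]
      · rw [Set.indicator_of_notMem h,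
          Set.indicator_of_notMem (fun h' => h ((insertNth_mem_argminSet i v y).2 h'))]
    simp_rw [h1]
    rw [lintegral_indicator, Measure.restrict_pi_pi, Measure.restrict_pi_pi]
    · congr 2
      funext j
      split_ifs
      · exact Measure.restrict_congr_set Ioi_ae_eq_Ici
      · rfl
    · refine MeasurableSet.univ_pi fun j => ?_
      split_ifs
      exacts [measurableSet_Ioi, measurableSet_Ici]
  rw [Finset.sum_congr rfl fun i _ => key i]
  simp

end Minimum

/-! ### Memorylessness and the minimum of an exponential sample -/

section Exponential

lemma expMeasure_eq_withDensity (r : ℝ) :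
    expMeasure r = volume.withDensity (exponentialPDF r) := rfl

@[fun_prop]
lemma measurable_exponentialPDF (r : ℝ) : Measurable (exponentialPDF r) :=
  (measurable_exponentialPDFReal r).ennreal_ofReal

instance nullSingletonClass_expMeasure (r : ℝ) : NullSingletonClass (expMeasure r) := by
  rw [expMeasure_eq_withDensity]; infer_instance

instance isProbabilityMeasure_expMeasure_one : IsProbabilityMeasure (expMeasure 1) :=
  isProbabilityMeasure_expMeasure one_pos

lemma lintegral_expMeasure (r : ℝ) {f : ℝ → ℝ≥0∞} (hf : Measurable f) :
    ∫⁻ x, f x ∂expMeasure r = ∫⁻ x, exponentialPDF r x * f x := by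
  rw [expMeasure_eq_withDensity, lintegral_withDensity_eq_lintegral_mul _ (by fun_prop) hf]
  rfl

lemma ae_nonneg_expMeasure (r : ℝ) : ∀ᵐ x ∂expMeasure r, 0 ≤ x := by
  rw [expMeasure_eq_withDensity, ae_withDensity_iff (by fun_prop)]
  refine ae_of_all _ fun x hx => ?_
  by_contra h
  exact hx (exponentialPDF_of_neg (not_le.1 h))

/-- The exponential distribution is memoryless. -/
lemma restrict_Ici_expMeasure_one {v : ℝ} (hv : 0 ≤ v) :
    (expMeasure 1).restrict (Set.Ici v) =
      ENNReal.ofReal (Real.exp (-v)) • (expMeasure 1).map (fun u => v + u) := by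
  ext s hs
  rw [Measure.restrict_apply hs, Measure.smul_apply, Measure.map_apply (by fun_prop) hs,
    expMeasure_eq_withDensity, withDensity_apply _ (hs.inter measurableSet_Ici),
    withDensity_apply _ (hs.preimage (by fun_prop)), smul_eq_mul,
    ← lintegral_const_mul _ (by fun_prop), ← lintegral_indicator (hs.inter measurableSet_Ici),
    ← lintegral_indicator (hs.preimage (by fun_prop)), ← lintegral_add_left_eq_self _ v]
  refine lintegral_congr fun u => ?_
  by_cases hu : 0 ≤ u
  · by_cases hus : v + u ∈ s
    · rw [Set.indicator_of_mem (by simp [hus, hu]), Set.indicator_of_mem (by simpa using hus),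
        exponentialPDF_of_nonneg (by positivity), exponentialPDF_of_nonneg hu,
        ← ENNReal.ofReal_mul (by positivity)]
      congr 1
      simp only [one_mul]
      rw [← Real.exp_add]
      ring_nf
    · rw [Set.indicator_of_notMem (by simp [hus]), Set.indicator_of_notMem (by simpa using hus)]
  · rw [Set.indicator_of_notMem (by simp [hu])]
    simp [Set.indicator, exponentialPDF_of_neg (not_le.1 hu)]

lemma restrict_pi_Ici_expMeasure_one (n : ℕ) {v : ℝ} (hv : 0 ≤ v) :
    (Measure.pi fun _ : Fin n => expMeasure 1).restrict (Set.univ.pi fun _ => Set.Ici v) =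
      ENNReal.ofReal (Real.exp (-v)) ^ n •
        (Measure.pi fun _ : Fin n => expMeasure 1).map (fun y j => v + y j) := by
  rw [Measure.restrict_pi_pi]
  refine Measure.pi_eq fun s hs => ?_
  have h1 (j : Fin n) : (expMeasure 1).restrict (Set.Ici v) (s j) =
      ENNReal.ofReal (Real.exp (-v)) * expMeasure 1 ((fun u => v + u) ⁻¹' s j) := by
    rw [restrict_Ici_expMeasure_one hv, Measure.smul_apply, Measure.map_apply (by fun_prop) (hs j),
      smul_eq_mul]
  have h2 : (fun (y : Fin n → ℝ) j => v + y j) ⁻¹' (Set.univ.pi s) =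
      Set.univ.pi fun j => (fun u => v + u) ⁻¹' s j := by
    ext; simp
  simp_rw [h1]
  rw [Measure.smul_apply, Measure.map_apply (by fun_prop) (MeasurableSet.univ_pi hs), h2,
    Measure.pi_pi, Finset.prod_mul_distrib]
  simp

/-- The minimum of `n + 1` independent standard exponential variables is exponential of rate
`n + 1`, and the exceedances of the other ones are again independent standard exponential. -/
lemma lintegral_pi_expMeasure_eq_minimum (n : ℕ) {F : (Fin (n + 1) → ℝ) → ℝ≥0∞}
    (hF : Measurable F) (hsymm : ∀ x (σ : Equiv.Perm (Fin (n + 1))), F (x ∘ σ) = F x) :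
    ∫⁻ x, F x ∂Measure.pi (fun _ => expMeasure 1) =
      ∫⁻ v, ∫⁻ y, F (Fin.cons v fun j => v + y j)
        ∂Measure.pi (fun _ : Fin n => expMeasure 1) ∂expMeasure (n + 1) := by
  have hcons : Measurable fun p : ℝ × (Fin n → ℝ) =>
      (Fin.cons p.1 p.2 : Fin (n + 1) → ℝ) := by
    refine measurable_pi_lambda _ fun j => ?_
    induction j using Fin.cases with
    | zero => simpa using measurable_fst
    | succ j => simp only [Fin.cons_succ]; fun_prop
  have hmeas : Measurable fun p : ℝ × (Fin n → ℝ) =>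
      F (Fin.cons p.1 fun j => p.1 + p.2 j) := by
    have : Measurable fun p : ℝ × (Fin n → ℝ) => (p.1, fun j => p.1 + p.2 j) := by fun_prop
    exact hF.comp (hcons.comp this)
  have hinner : Measurable fun v => ∫⁻ y, F (Fin.cons v fun j => v + y j)
      ∂Measure.pi (fun _ : Fin n => expMeasure 1) := hmeas.lintegral_prod_right'
  rw [lintegral_pi_eq_minimum _ hF hsymm]
  have h1 : ∫⁻ v, ∫⁻ y in Set.univ.pi (fun _ => Set.Ici v), F (Fin.cons v y)
        ∂Measure.pi (fun _ : Fin n => expMeasure 1) ∂expMeasure 1 =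
      ∫⁻ v, ENNReal.ofReal (Real.exp (-v)) ^ n * ∫⁻ y, F (Fin.cons v fun j => v + y j)
        ∂Measure.pi (fun _ : Fin n => expMeasure 1) ∂expMeasure 1 := by
    refine lintegral_congr_ae ?_
    filter_upwards [ae_nonneg_expMeasure 1] with v hv
    rw [restrict_pi_Ici_expMeasure_one n hv, lintegral_smul_measure, lintegral_map, smul_eq_mul]
    · exact hF.comp (hcons.comp (by fun_prop : Measurable fun y : Fin n → ℝ => (v, y)))
    · fun_prop
  rw [h1, lintegral_expMeasure _ (by fun_prop), lintegral_expMeasure _ (by fun_prop),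
    ← lintegral_const_mul _ (by fun_prop)]
  -- On `v ≥ 0` the weight `(n + 1) e^{-v} (e^{-v})^n` is the exponential density of rate `n + 1`.
  refine lintegral_congr fun v => ?_
  rw [← mul_assoc, ← mul_assoc]
  congr 1
  by_cases hv : 0 ≤ v
  · rw [exponentialPDF_of_nonneg hv, exponentialPDF_of_nonneg hv, ← ENNReal.ofReal_pow
      (by positivity), mul_assoc, ← ENNReal.ofReal_mul (by positivity)]
    have : ((n : ℝ≥0∞) + 1) = ENNReal.ofReal (n + 1) := by
      rw [ENNReal.ofReal_add (by positivity) (by positivity)]; simp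
    rw [this, ← ENNReal.ofReal_mul (by positivity)]
    congr 1
    rw [← Real.exp_nat_mul, one_mul, ← Real.exp_add]
    ring_nf
  · rw [exponentialPDF_of_neg (not_le.1 hv), exponentialPDF_of_neg (not_le.1 hv)]
    simp

end Exponential

end ParetoOrder

namespace ParetoOrder

open MeasureTheory ProbabilityTheory
open scoped ENNReal

/-! ### Rényi's representation via characteristic functions -/

section CharFun

lemma charFun_expMeasure {r : ℝ} (hr : 0 < r) (t : ℝ) :
    charFun (expMeasure r) t = (1 - Complex.I * t / r)⁻¹ := by
  have hr' : (r : ℂ) ≠ 0 := by exact_mod_cast hr.ne'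
  have hre : (Complex.I * t - r).re < 0 := by simpa using hr
  have hne : Complex.I * t - r ≠ 0 := fun h => by simp [h] at hre
  rw [charFun_apply_real, expMeasure_eq_withDensity,
    integral_withDensity_eq_integral_toReal_smul (measurable_exponentialPDF r)
      (ae_of_all _ fun x => (ENNReal.ofReal_lt_top : exponentialPDF r x < ⊤))]
  have h1 (x : ℝ) : (exponentialPDF r x).toReal • Complex.exp (t * x * Complex.I) =
      (Set.Ici 0).indicator (fun x : ℝ => (r : ℂ) * Complex.exp ((Complex.I * t - r) * x)) x := by
    by_cases hx : 0 ≤ x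
    · rw [Set.indicator_of_mem (by simpa using hx), exponentialPDF_of_nonneg hx,
        ENNReal.toReal_ofReal (by positivity), Complex.real_smul]
      push_cast
      rw [mul_assoc, ← Complex.exp_add]
      ring_nf
    · rw [Set.indicator_of_notMem (by simpa using hx), exponentialPDF_of_neg (not_le.1 hx)]
      simp
  simp_rw [h1]
  rw [integral_indicator measurableSet_Ici, integral_Ici_eq_integral_Ioi, integral_const_mul,
    integral_exp_mul_complex_Ioi hre]
  have hfac : 1 - Complex.I * t / r = -(Complex.I * t - r) / r := by
    field_simp
    ring
  rw [hfac, inv_div, Complex.ofReal_zero, mul_zero, Complex.exp_zero]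
  rw [neg_div, mul_neg, mul_one_div, div_neg]

/-- The joint behaviour of two order statistics under removal of the minimum of an exponential
sample: the spacing is unchanged. -/
lemma map_orderStat_sub_orderStat_succ (n a b : ℕ) (ha : a ≤ n) (hb : b ≤ n) :
    (Measure.pi fun _ : Fin (n + 1) => expMeasure 1).map
        (fun x => orderStat x (b + 1) - orderStat x (a + 1)) =
      (Measure.pi fun _ : Fin n => expMeasure 1).map
        (fun y => orderStat y b - orderStat y a) := by
  have : IsProbabilityMeasure (expMeasure (n + 1)) := isProbabilityMeasure_expMeasure (by positivity)
  refine Measure.ext_of_lintegral _ fun f hf => ?_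
  rw [lintegral_map hf (by fun_prop), lintegral_map hf (by fun_prop),
    lintegral_pi_expMeasure_eq_minimum n (by fun_prop)
      (fun x σ => by rw [orderStat_comp_perm, orderStat_comp_perm])]
  have h (v : ℝ) : ∫⁻ y, f (orderStat (Fin.cons v fun j => v + y j : Fin (n + 1) → ℝ) (b + 1) -
        orderStat (Fin.cons v fun j => v + y j : Fin (n + 1) → ℝ) (a + 1))
        ∂Measure.pi (fun _ : Fin n => expMeasure 1) =
      ∫⁻ y, f (orderStat y b - orderStat y a) ∂Measure.pi (fun _ : Fin n => expMeasure 1) := by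
    refine lintegral_congr_ae ?_
    filter_upwards [Filter.eventually_all.2 fun j => Measure.tendsto_eval_ae_ae (i := j)
      |>.eventually (ae_nonneg_expMeasure 1)] with y hy
    rw [orderStat_cons_add v y hy hb, orderStat_cons_add v y hy ha, add_sub_add_left_eq_sub]
  simp_rw [h]
  simp

/-- One step of Rényi's recursion: the minimum, plus an independent order statistic of the
exceedances. -/
lemma map_orderStat_succ (n b : ℕ) (hb : b ≤ n) :
    (Measure.pi fun _ : Fin (n + 1) => expMeasure 1).map (fun x => orderStat x (b + 1)) =
      expMeasure (n + 1) ∗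
        (Measure.pi fun _ : Fin n => expMeasure 1).map (fun y => orderStat y b) := by
  have : IsProbabilityMeasure (expMeasure (n + 1)) := isProbabilityMeasure_expMeasure (by positivity)
  have : IsProbabilityMeasure ((Measure.pi fun _ : Fin n => expMeasure 1).map
    (fun y => orderStat y b)) := Measure.isProbabilityMeasure_map (by fun_prop)
  refine Measure.ext_of_lintegral _ fun f hf => ?_
  rw [lintegral_map hf (by fun_prop), Measure.lintegral_conv hf,
    lintegral_pi_expMeasure_eq_minimum n (by fun_prop) (fun x σ => by rw [orderStat_comp_perm])]
  refine lintegral_congr fun v => ?_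
  rw [lintegral_map (by fun_prop) (by fun_prop)]
  refine lintegral_congr_ae ?_
  filter_upwards [Filter.eventually_all.2 fun j => Measure.tendsto_eval_ae_ae (i := j)
    |>.eventually (ae_nonneg_expMeasure 1)] with y hy
  rw [orderStat_cons_add v y hy hb]

/-- The characteristic function of the `b`-th order statistic of `m + b` independent standard
exponential variables. -/
lemma charFun_map_orderStat (m b : ℕ) (t : ℝ) :
    charFun ((Measure.pi fun _ : Fin (m + b) => expMeasure 1).map (fun x => orderStat x b)) t =
      ∏ j ∈ Finset.range b, (1 - Complex.I * t / (m + j + 1))⁻¹ := by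
  induction b with
  | zero => simp [charFun_dirac]
  | succ b ih =>
    have : IsProbabilityMeasure (expMeasure ((m + b : ℕ) + 1)) :=
      isProbabilityMeasure_expMeasure (by positivity)
    have : IsProbabilityMeasure ((Measure.pi fun _ : Fin (m + b) => expMeasure 1).map
      (fun y => orderStat y b)) := Measure.isProbabilityMeasure_map (by fun_prop)
    have h := map_orderStat_succ (m + b) b (by omega)
    rw [show m + (b + 1) = m + b + 1 by omega, h, charFun_conv, ih,
      charFun_expMeasure (by positivity), Finset.prod_range_succ, mul_comm]
    push_cast
    rfl

/-- Discarding the minimum `a` times leaves the spacing's law unchanged and turns its lower end into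
the origin. -/
lemma map_orderStat_sub_orderStat (N a b : ℕ) (hb : b ≤ N) :
    (Measure.pi fun _ : Fin (N + a) => expMeasure 1).map
        (fun x => orderStat x (b + a) - orderStat x a) =
      (Measure.pi fun _ : Fin N => expMeasure 1).map (fun y => orderStat y b) := by
  induction a with
  | zero => simp
  | succ a ih =>
    rw [← ih]
    exact map_orderStat_sub_orderStat_succ (N + a) a (b + a) (by omega) (by omega)

/-- The characteristic function of a spacing of independent standard exponential variables. -/
lemma charFun_map_orderStat_sub_orderStat {n a c m b : ℕ} (hn : n = m + b + a) (hc : c = b + a)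
    (t : ℝ) :
    charFun ((Measure.pi fun _ : Fin n => expMeasure 1).map
        (fun x => orderStat x c - orderStat x a)) t =
      ∏ j ∈ Finset.range b, (1 - Complex.I * t / (m + j + 1))⁻¹ := by
  subst hn hc
  rw [map_orderStat_sub_orderStat _ _ _ (by omega), charFun_map_orderStat]

end CharFun

end ParetoOrder

namespace ParetoOrder

open Filter Topology Finset

/-! ### Bounds for partial sums of `1/(k+j)` and `1/(k+j)²` -/

section Sums

/-- Each term obeys `1/(m+1) ≤ log ((m+1)/m) ≤ 1/m`, and both the logarithms and the gaps `1/m -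
1/(m+1)` telescope. -/
lemma sum_inv_bounds {k : ℝ} (hk : 0 < k) (b : ℕ) :
    Real.log ((k + b) / k) ≤ ∑ j ∈ range b, 1 / (k + j) ∧
      ∑ j ∈ range b, 1 / (k + j) ≤ Real.log ((k + b) / k) + (1 / k - 1 / (k + b)) := by
  induction b with
  | zero => simp [hk.ne']
  | succ b ih =>
    have hm : 0 < k + b := by positivity
    have hm' : 0 < k + b + 1 := by positivity
    have hlog : Real.log ((k + (b + 1 : ℕ)) / k) =
        Real.log ((k + b) / k) + Real.log ((k + b + 1) / (k + b)) := by
      rw [← Real.log_mul (by positivity) (by positivity)]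
      congr 1
      push_cast
      field_simp
      ring
    have h1 : Real.log ((k + b + 1) / (k + b)) ≤ 1 / (k + b) := by
      refine (Real.log_le_sub_one_of_pos (by positivity)).trans (le_of_eq ?_)
      field_simp
      ring
    have h2 : 1 / (k + b + 1) ≤ Real.log ((k + b + 1) / (k + b)) := by
      refine le_trans (le_of_eq ?_) (Real.one_sub_inv_le_log_of_pos (by positivity))
      field_simp
      ring
    rw [sum_range_succ, hlog]
    push_cast
    rw [← add_assoc k]
    constructor <;> linarith [ih.1, ih.2]

/-- Compare with the telescoping `1/(m(m+1))`, which lies between `1/(m+1)²` and `1/m²`. -/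
lemma sum_inv_sq_bounds {k : ℝ} (hk : 0 < k) (b : ℕ) :
    1 / k - 1 / (k + b) ≤ ∑ j ∈ range b, 1 / (k + j) ^ 2 ∧
      ∑ j ∈ range b, 1 / (k + j) ^ 2 ≤
        (1 / k - 1 / (k + b)) + (1 / k ^ 2 - 1 / (k + b) ^ 2) := by
  induction b with
  | zero => simp
  | succ b ih =>
    have hm : 0 < k + b := by positivity
    have hm' : 0 < k + b + 1 := by positivity
    have h0 : 1 / (k + b) - 1 / (k + b + 1) = 1 / ((k + b) * (k + b + 1)) := by
      field_simp
      ring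
    have h1 : 1 / ((k + b) * (k + b + 1)) ≤ 1 / (k + b) ^ 2 :=
      one_div_le_one_div_of_le (by positivity) (by nlinarith)
    have h2 : 1 / (k + b + 1) ^ 2 ≤ 1 / ((k + b) * (k + b + 1)) :=
      one_div_le_one_div_of_le (by positivity) (by nlinarith)
    rw [sum_range_succ]
    push_cast
    rw [← add_assoc k]
    constructor <;> linarith [ih.1, ih.2]

end Sums

/-! ### Asymptotics of the characteristic function -/

section Limits

variable {s : ℕ}

lemma tendsto_sampleSize_div (s : ℕ) :
    Tendsto (fun k : ℕ => ((k : ℝ) * (s + 1) - 1) / k) atTop (𝓝 (s + 1)) := by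
  have h : Tendsto (fun k : ℕ => (s + 1 : ℝ) - 1 / (k : ℝ)) atTop (𝓝 (s + 1 - 0)) :=
    tendsto_const_nhds.sub tendsto_one_div_atTop_nhds_zero_nat
  rw [sub_zero] at h
  refine h.congr' ?_
  filter_upwards [eventually_ge_atTop 1] with k hk
  have : (0 : ℝ) < k := by exact_mod_cast hk
  field_simp

lemma tendsto_sqrt_sampleSize_div (s : ℕ) :
    Tendsto (fun k : ℕ => √((k : ℝ) * (s + 1) - 1) / k) atTop (𝓝 0) := by
  have h : Tendsto (fun k : ℕ => √(((k : ℝ) * (s + 1) - 1) / k * (1 / k))) atTop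
      (𝓝 √((s + 1) * 0)) :=
    ((tendsto_sampleSize_div s).mul tendsto_one_div_atTop_nhds_zero_nat).sqrt
  rw [mul_zero, Real.sqrt_zero] at h
  refine h.congr fun k => ?_
  rw [div_mul_div_comm, mul_one, Real.sqrt_div' _ (by positivity),
    Real.sqrt_mul_self (by positivity)]

lemma cast_sub_block (hs : 2 ≤ s) (k : ℕ) : ((k * s - k : ℕ) : ℝ) = k * (s - 1) := by
  rw [Nat.cast_sub (Nat.le_mul_of_pos_right k (by omega))]
  push_cast
  ring

/-- The sum exceeds `log s` by at most `1/k`, whereas `√n` has order `√k`; this permits centring at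
`log s` instead of the harmonic difference. -/
lemma tendsto_sqrt_mul_sum_inv_sub_log (hs : 2 ≤ s) :
    Tendsto (fun k : ℕ => √((k : ℝ) * (s + 1) - 1) *
      (∑ j ∈ range (k * s - k), 1 / ((k : ℝ) + j) - Real.log s)) atTop (𝓝 0) := by
  refine squeeze_zero' ?_ ?_ (tendsto_sqrt_sampleSize_div s)
  all_goals
    filter_upwards [eventually_ge_atTop 1] with k hk
    have hk' : (0 : ℝ) < k := by exact_mod_cast hk
    obtain ⟨h1, h2⟩ := sum_inv_bounds hk' (k * s - k)
    have hq : ((k : ℝ) + (k * s - k : ℕ)) / k = s := by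
      rw [cast_sub_block hs]
      field_simp
      ring
    rw [hq] at h1 h2
  · exact mul_nonneg (Real.sqrt_nonneg _) (by linarith)
  · rw [div_eq_mul_one_div]
    refine mul_le_mul_of_nonneg_left ?_ (Real.sqrt_nonneg _)
    have : 0 ≤ 1 / ((k : ℝ) + (k * s - k : ℕ)) := by positivity
    linarith

lemma tendsto_sampleSize_mul_sum_inv_sq (hs : 2 ≤ s) :
    Tendsto (fun k : ℕ => ((k : ℝ) * (s + 1) - 1) *
      ∑ j ∈ range (k * s - k), 1 / ((k : ℝ) + j) ^ 2) atTop (𝓝 (((s : ℝ) ^ 2 - 1) / s)) := by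
  have hs0 : (0 : ℝ) < s := by positivity
  have hlim : ((s : ℝ) ^ 2 - 1) / s = (s + 1) * (1 - 1 / s) := by
    field_simp
    ring
  have hlow : Tendsto (fun k : ℕ => ((k : ℝ) * (s + 1) - 1) / k * (1 - 1 / (s : ℝ))) atTop
      (𝓝 (((s : ℝ) ^ 2 - 1) / s)) := by
    rw [hlim]
    exact (tendsto_sampleSize_div s).mul_const _
  have hup : Tendsto (fun k : ℕ => ((k : ℝ) * (s + 1) - 1) / k * (1 - 1 / (s : ℝ)) +
      ((k : ℝ) * (s + 1) - 1) / k * (1 / k)) atTop (𝓝 (((s : ℝ) ^ 2 - 1) / s)) := by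
    simpa using hlow.add ((tendsto_sampleSize_div s).mul tendsto_one_div_atTop_nhds_zero_nat)
  refine tendsto_of_tendsto_of_tendsto_of_le_of_le' hlow hup ?_ ?_
  all_goals
    filter_upwards [eventually_ge_atTop 1] with k hk
    have hk1 : (1 : ℝ) ≤ k := by exact_mod_cast hk
    have hk' : (0 : ℝ) < k := by linarith
    have hn : 0 ≤ (k : ℝ) * (s + 1) - 1 := by nlinarith
    obtain ⟨h1, h2⟩ := sum_inv_sq_bounds hk' (k * s - k)
    have hq : (k : ℝ) + (k * s - k : ℕ) = k * s := by
      rw [cast_sub_block hs]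
      ring
    rw [hq] at h1 h2
  · rw [div_mul_eq_mul_div, mul_div_assoc]
    refine mul_le_mul_of_nonneg_left (le_trans (le_of_eq ?_) h1) hn
    field_simp
  · rw [div_mul_eq_mul_div, mul_div_assoc, div_mul_eq_mul_div, mul_div_assoc, ← mul_add]
    refine mul_le_mul_of_nonneg_left (h2.trans ?_) hn
    have h3 : 1 / (k : ℝ) - 1 / (k * s) = (1 - 1 / (s : ℝ)) / k := by field_simp
    have h4 : 0 ≤ 1 / ((k : ℝ) * s) ^ 2 := by positivity
    have h5 : 1 / (k : ℝ) / k = 1 / k ^ 2 := by field_simp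
    linarith

/-- The Taylor remainder is at most `‖z‖³ (1 - ‖z‖)⁻¹ / 3`, and `(1 - ‖z‖)⁻¹ ≤ 2` on this disc. -/
lemma norm_log_one_sub_inv_sub_le {z : ℂ} (hz : ‖z‖ ≤ 1 / 2) :
    ‖Complex.log (1 - z)⁻¹ - (z + z ^ 2 / 2)‖ ≤ ‖z‖ ^ 3 := by
  have h := Complex.norm_log_one_sub_inv_add_logTaylor_neg_le 2 (z := z) (by linarith)
  have h1 : Complex.logTaylor 3 (-z) = -(z + z ^ 2 / 2) := by
    simp [Complex.logTaylor, sum_range_succ]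
    ring
  norm_num at h
  rw [h1] at h
  rw [sub_eq_add_neg]
  refine h.trans ?_
  have h2 : (1 - ‖z‖)⁻¹ ≤ 2 := by
    rw [inv_le_comm₀ (by linarith) (by norm_num)]
    linarith
  have h3 : 0 ≤ ‖z‖ ^ 3 := by positivity
  nlinarith [mul_le_mul_of_nonneg_left h2 h3]

/-- The limit of the centred and scaled characteristic function of the spacing. -/
lemma tendsto_exp_mul_prod (hs : 2 ≤ s) (t : ℝ) :
    Tendsto (fun k : ℕ => Complex.exp (-(Complex.I * (√((k : ℝ) * (s + 1) - 1) * t : ℝ) *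
        Real.log s)) * ∏ j ∈ range (k * s - k),
          (1 - Complex.I * (√((k : ℝ) * (s + 1) - 1) * t : ℝ) / (k + j))⁻¹) atTop
      (𝓝 (Complex.exp (-(((s : ℝ) ^ 2 - 1) / s * t ^ 2 / 2 : ℝ)))) := by
  set u : ℕ → ℝ := fun k => √((k : ℝ) * (s + 1) - 1) * t with hu
  set z : ℕ → ℕ → ℂ := fun k j => Complex.I * u k / (k + j) with hz
  set R : ℕ → ℂ := fun k => ∑ j ∈ range (k * s - k),
    (Complex.log (1 - z k j)⁻¹ - (z k j + z k j ^ 2 / 2)) with hR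
  have hρ := tendsto_sqrt_sampleSize_div s
  have hu0 : Tendsto (fun k => |u k| / k) atTop (𝓝 0) := by
    have := hρ.mul_const |t|
    rw [zero_mul] at this
    refine this.congr fun k => ?_
    rw [hu, abs_mul, abs_of_nonneg (Real.sqrt_nonneg _)]
    ring
  have hzle (k j : ℕ) (hk : 1 ≤ k) : ‖z k j‖ ≤ |u k| / k := by
    have hk' : (0 : ℝ) < k := by exact_mod_cast hk
    have : ‖(k : ℂ) + j‖ = k + j := by
      have h : ((k : ℂ) + j) = ((k + j : ℕ) : ℂ) := by push_cast; rfl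
      rw [h, Complex.norm_natCast]
      push_cast
      rfl
    rw [hz, norm_div, this, norm_mul, Complex.norm_I, one_mul, Complex.norm_real, Real.norm_eq_abs]
    gcongr
    linarith [(Nat.cast_nonneg j : (0 : ℝ) ≤ j)]
  have hhalf : ∀ᶠ k in atTop, |u k| / k ≤ 1 / 2 := by
    filter_upwards [hu0.eventually_lt_const (by norm_num : (0 : ℝ) < 1 / 2)] with k hk using hk.le
  -- There are `k(s-1)` remainders, each `O(k^{-3/2})`, so their sum is `O(k^{-1/2})`.
  have hRlim : Tendsto R atTop (𝓝 0) := by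
    have hb : Tendsto (fun k : ℕ => (s - 1 : ℝ) * |t| ^ 2 * (((k : ℝ) * (s + 1) - 1) / k) *
        (|u k| / k)) atTop (𝓝 0) := by
      have := ((tendsto_sampleSize_div s).const_mul ((s - 1 : ℝ) * |t| ^ 2)).mul hu0
      rwa [mul_zero] at this
    refine squeeze_zero_norm' ?_ hb
    filter_upwards [hhalf, eventually_ge_atTop 1] with k hk hk1
    have hk1' : (1 : ℝ) ≤ k := by exact_mod_cast hk1
    have hn : 0 ≤ (k : ℝ) * (s + 1) - 1 := by
      have : (0 : ℝ) ≤ s := by positivity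
      nlinarith
    calc ‖R k‖ ≤ ∑ j ∈ range (k * s - k), (|u k| / k) ^ 3 := by
          refine norm_sum_le_of_le _ fun j _ => ?_
          refine (norm_log_one_sub_inv_sub_le ((hzle k j hk1).trans hk)).trans ?_
          gcongr
          exact hzle k j hk1
      _ = _ := by
          rw [sum_const, card_range, nsmul_eq_mul, cast_sub_block hs]
          have h2 : |u k| ^ 2 = ((k : ℝ) * (s + 1) - 1) * |t| ^ 2 := by
            rw [hu, abs_mul, mul_pow, abs_of_nonneg (Real.sqrt_nonneg _), Real.sq_sqrt hn]
          have hk0 : (k : ℝ) ≠ 0 := by positivity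
          calc (k : ℝ) * (s - 1) * (|u k| / k) ^ 3 = (s - 1) * |u k| ^ 2 * |u k| / k ^ 2 := by
                field_simp
            _ = _ := by
                rw [h2]
                field_simp
  -- The whole exponent: a centred linear term tending to 0, a quadratic term giving the variance,
  -- and the remainder.
  have hmain : Tendsto (fun k => Complex.I * ((u k * (∑ j ∈ range (k * s - k), 1 / ((k : ℝ) + j) -
        Real.log s) : ℝ) : ℂ) - (((u k) ^ 2 * (∑ j ∈ range (k * s - k), 1 / ((k : ℝ) + j) ^ 2) / 2
        : ℝ) : ℂ) + R k) atTop
      (𝓝 (Complex.I * ((0 : ℝ) : ℂ) - ((((s : ℝ) ^ 2 - 1) / s * t ^ 2 / 2 : ℝ) : ℂ) + 0)) := by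
    refine (Tendsto.sub (Tendsto.const_mul _ ?_) ?_).add hRlim
    · refine (Complex.continuous_ofReal.tendsto 0).comp ?_
      have := (tendsto_sqrt_mul_sum_inv_sub_log hs).mul_const t
      rw [zero_mul] at this
      exact this.congr fun k => by rw [hu]; ring
    · refine (Complex.continuous_ofReal.tendsto _).comp ?_
      refine Tendsto.congr' ?_
        (((tendsto_sampleSize_mul_sum_inv_sq hs).mul_const (t ^ 2)).div_const 2)
      filter_upwards [eventually_ge_atTop 1] with k hk1
      have hk1' : (1 : ℝ) ≤ k := by exact_mod_cast hk1
      have hn : 0 ≤ (k : ℝ) * (s + 1) - 1 := by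
        have : (0 : ℝ) ≤ s := by positivity
        nlinarith
      rw [hu, mul_pow, Real.sq_sqrt hn]
      ring
  have hexp := (Complex.continuous_exp.tendsto _).comp hmain
  simp only [Complex.ofReal_zero, mul_zero, zero_sub, add_zero] at hexp
  refine hexp.congr' ?_
  filter_upwards [hhalf, eventually_ge_atTop 1] with k hk hk1
  have hne (j : ℕ) : (1 - z k j)⁻¹ ≠ 0 := by
    refine inv_ne_zero fun h => ?_
    have h1 : z k j = 1 := (sub_eq_zero.1 h).symm
    have h2 := (hzle k j hk1).trans hk
    rw [h1] at h2
    norm_num at h2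
  -- Principal logarithms are taken factor by factor and only re-exponentiated, so no branch of the
  -- logarithm of the product has to be chosen.
  have hprod : ∏ j ∈ range (k * s - k), (1 - z k j)⁻¹ =
      Complex.exp (∑ j ∈ range (k * s - k), Complex.log (1 - z k j)⁻¹) := by
    rw [Complex.exp_sum]
    exact prod_congr rfl fun j _ => (Complex.exp_log (hne j)).symm
  have hlogs : ∑ j ∈ range (k * s - k), Complex.log (1 - z k j)⁻¹ =
      Complex.I * u k * ∑ j ∈ range (k * s - k), 1 / ((k : ℂ) + j) -
        (u k : ℂ) ^ 2 * (∑ j ∈ range (k * s - k), 1 / ((k : ℂ) + j) ^ 2) / 2 + R k := by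
    have : Complex.I * u k * ∑ j ∈ range (k * s - k), 1 / ((k : ℂ) + j) -
        (u k : ℂ) ^ 2 * (∑ j ∈ range (k * s - k), 1 / ((k : ℂ) + j) ^ 2) / 2 =
        ∑ j ∈ range (k * s - k), (z k j + z k j ^ 2 / 2) := by
      rw [mul_sum, mul_sum, sum_div, ← sum_sub_distrib]
      refine sum_congr rfl fun j _ => ?_
      simp only [hz, div_pow, mul_pow, Complex.I_sq]
      ring
    rw [this, hR, ← sum_add_distrib]
    exact sum_congr rfl fun j _ => by ring
  change _ = Complex.exp (-(Complex.I * (u k : ℝ) * Real.log s)) *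
    ∏ j ∈ range (k * s - k), (1 - z k j)⁻¹
  rw [hprod, hlogs, ← Complex.exp_add, Function.comp_apply]
  congr 1
  push_cast
  ring

end Limits

end ParetoOrder

namespace ParetoOrder

open MeasureTheory ProbabilityTheory

/-! ### From Pareto to exponential variables -/

section Pareto

variable {α δ : ℝ}

lemma paretoMeasure_Ioi (hα : 0 < α) (hδ : 0 < δ) {y : ℝ} (hy : δ ≤ y) :
    (paretoMeasure δ α).real (Set.Ioi y) = (δ / y) ^ α := by
  have hy0 : 0 < y := hδ.trans_le hy
  rw [measureReal_def, paretoMeasure, withDensity_apply _ measurableSet_Ioi,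
    setLIntegral_congr_fun (g := fun x => ENNReal.ofReal (α * δ ^ α * x ^ (-(α + 1))))
      measurableSet_Ioi (fun x hx => paretoPDF_of_le (hy.trans (le_of_lt hx))),
    ← integral_eq_lintegral_of_nonneg_ae, integral_const_mul,
    integral_Ioi_rpow_of_lt (by linarith) hy0, Real.div_rpow hδ.le hy0.le]
  · have h : -(α + 1) + 1 = -α := by ring
    rw [h, Real.rpow_neg hy0.le]
    field_simp
  · refine (ae_restrict_iff' measurableSet_Ioi).2 (ae_of_all _ fun x hx => ?_)
    have : 0 < x := hy0.trans hx
    simp only [Pi.zero_apply]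
    positivity
  · fun_prop

lemma ae_le_paretoMeasure (α δ : ℝ) : ∀ᵐ x ∂paretoMeasure δ α, δ ≤ x := by
  have hm : Measurable (paretoPDF δ α) := (measurable_paretoPDFReal δ α).ennreal_ofReal
  rw [paretoMeasure, ae_withDensity_iff hm]
  refine ae_of_all _ fun x hx => ?_
  by_contra h
  exact hx (paretoPDF_of_lt (not_le.1 h))

/-- The logarithm of a Pareto variable is exponential. -/
lemma map_log_paretoMeasure (hα : 0 < α) (hδ : 0 < δ) :
    (paretoMeasure δ α).map (fun x => α * Real.log (x / δ)) = expMeasure 1 := by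
  have := isProbabilityMeasure_paretoMeasure hδ hα
  have hm : Measurable fun x => α * Real.log (x / δ) := by fun_prop
  have : IsProbabilityMeasure ((paretoMeasure δ α).map (fun x => α * Real.log (x / δ))) :=
    Measure.isProbabilityMeasure_map hm.aemeasurable
  refine Measure.eq_of_cdf _ _ (StieltjesFunction.ext fun t => ?_)
  rw [cdf_expMeasure_eq one_pos, cdf_eq_real, ← Set.compl_Ioi, probReal_compl_eq_one_sub
    measurableSet_Ioi, map_measureReal_apply hm measurableSet_Ioi]
  split_ifs with ht
  · have hset : (fun x => α * Real.log (x / δ)) ⁻¹' Set.Ioi t =ᵐ[paretoMeasure δ α]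
        Set.Ioi (δ * Real.exp (t / α)) := by
      filter_upwards [ae_le_paretoMeasure α δ] with x hx
      have hx0 : 0 < x := hδ.trans_le hx
      refine propext ?_
      change t < α * Real.log (x / δ) ↔ δ * Real.exp (t / α) < x
      rw [← div_lt_iff₀' hα, Real.lt_log_iff_exp_lt (by positivity), lt_div_iff₀' hδ]
    rw [measureReal_congr hset, paretoMeasure_Ioi hα hδ
      (le_mul_of_one_le_right hδ.le (Real.one_le_exp (by positivity)))]
    congr 1
    rw [div_mul_eq_div_div, div_self hδ.ne', one_div, ← Real.exp_neg, ← Real.exp_mul]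
    congr 1
    field_simp
  · have hset : (fun x => α * Real.log (x / δ)) ⁻¹' Set.Ioi t =ᵐ[paretoMeasure δ α] Set.univ := by
      filter_upwards [ae_le_paretoMeasure α δ] with x hx
      refine propext ?_
      change t < α * Real.log (x / δ) ↔ True
      have := Real.log_nonneg ((one_le_div hδ).2 hx)
      simp only [iff_true]
      nlinarith [mul_nonneg hα.le this]
    rw [measureReal_congr hset]
    simp

end Pareto

end ParetoOrder

namespace ParetoOrder

open MeasureTheory ProbabilityTheory Filter Topology

/-! ### Quantiles of the standard normal distribution -/

section Quantile

lemma continuous_cdf_of_nullSingletonClass (μ : Measure ℝ) [IsProbabilityMeasure μ]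
    [NullSingletonClass μ] : Continuous (cdf μ) := by
  refine continuous_iff_continuousAt.2 fun x => ?_
  rw [(monotone_cdf μ).continuousAt_iff_leftLim_eq_rightLim, StieltjesFunction.rightLim_eq]
  have h := (cdf μ).measure_singleton x
  rw [measure_cdf, measure_singleton, eq_comm, ENNReal.ofReal_eq_zero] at h
  exact le_antisymm ((monotone_cdf μ).leftLim_le le_rfl) (by linarith)

instance nullSingletonClass_stdGaussian : NullSingletonClass (gaussianReal 0 1) :=
  nullSingletonClass_gaussianReal one_ne_zero

/-- By continuity of the distribution function the infimum is attained, which gives `≥`; points to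
its left have values below `p`, and the left limit gives `≤`. -/
lemma cdf_normalQuantile {p : ℝ} (hp0 : 0 < p) (hp1 : p < 1) :
    cdf (gaussianReal 0 1) (normalQuantile p) = p := by
  set F := cdf (gaussianReal 0 1) with hF
  have hcont : Continuous F := continuous_cdf_of_nullSingletonClass _
  set S : Set ℝ := {z : ℝ | p ≤ F z} with hS
  have hne : S.Nonempty := by
    obtain ⟨z, hz⟩ := ((tendsto_cdf_atTop (gaussianReal 0 1)).eventually_const_lt hp1).exists
    exact ⟨z, hz.le⟩
  have hbdd : BddBelow S := by
    obtain ⟨z, hz⟩ := ((tendsto_cdf_atBot (gaussianReal 0 1)).eventually_lt_const hp0).exists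
    refine ⟨z, fun w hw => ?_⟩
    by_contra h
    exact absurd ((monotone_cdf _) (not_le.1 h).le) (not_le.2 (hz.trans_le hw))
  have hclosed : IsClosed S := isClosed_le continuous_const hcont
  have hq : normalQuantile p = sInf S := rfl
  refine le_antisymm ?_ (hq ▸ hclosed.csInf_mem hne hbdd)
  have hleft : Tendsto F (𝓝[<] normalQuantile p) (𝓝 (F (normalQuantile p))) :=
    (hcont.tendsto _).mono_left nhdsWithin_le_nhds
  refine le_of_tendsto hleft ?_
  filter_upwards [self_mem_nhdsWithin] with z hz
  by_contra h
  exact absurd (csInf_le hbdd (not_le.1 h).le) (not_le.2 (hq ▸ hz))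

lemma cdf_stdGaussian_neg (z : ℝ) :
    cdf (gaussianReal 0 1) (-z) = 1 - cdf (gaussianReal 0 1) z := by
  have h : gaussianReal 0 1 = (gaussianReal 0 1).map (fun x => -x) := by
    rw [gaussianReal_map_neg, neg_zero]
  rw [cdf_eq_real, cdf_eq_real]
  nth_rewrite 1 [h]
  rw [map_measureReal_apply measurable_neg measurableSet_Iic, ← probReal_compl_eq_one_sub
    measurableSet_Iic, Set.compl_Iic]
  have : (fun x : ℝ => -x) ⁻¹' Set.Iic (-z) = Set.Ici z := by ext; simp
  rw [this]
  exact (measureReal_congr Ioi_ae_eq_Ici).symm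

/-- The symmetric interval bounded by the `1 - a / 2` quantile has standard normal mass `1 - a`. -/
lemma stdGaussian_Icc_normalQuantile {a : ℝ} (ha0 : 0 < a) (ha1 : a < 1) :
    (gaussianReal 0 1).real
      (Set.Icc (-normalQuantile (1 - a / 2)) (normalQuantile (1 - a / 2))) = 1 - a := by
  set z := normalQuantile (1 - a / 2)
  have hz : cdf (gaussianReal 0 1) z = 1 - a / 2 :=
    cdf_normalQuantile (by linarith) (by linarith)
  have hneg := cdf_stdGaussian_neg z
  have hz0 : -z ≤ z := by
    by_contra h
    have := (monotone_cdf (gaussianReal 0 1)) (not_le.1 h).le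
    linarith
  have hdiff : Set.Ioc (-z) z = Set.Iic z \ Set.Iic (-z) := by
    ext
    simp [and_comm]
  rw [← measureReal_congr (Ioc_ae_eq_Icc (a := -z) (b := z)), hdiff,
    measureReal_sdiff (Set.Iic_subset_Iic.2 hz0) measurableSet_Iic, ← cdf_eq_real, ← cdf_eq_real]
  linarith

end Quantile

/-! ### The log-ratio of a Pareto sample -/

section Sample

variable {α δ : ℝ} {s k : ℕ}

/-- The last identity counts `k - 1` observations above the `ks`-th order statistic, `ks - k` from
there down to just above the `k`-th, and `k` at or below it. The `k - 1` on top make `k` the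
smallest rate in the spacing. -/
lemma index_bounds (hs : 2 ≤ s) (hk : 1 ≤ k) :
    k ≤ k * s ∧ k * s ≤ k * (s + 1) - 1 ∧ k * (s + 1) - 1 = k - 1 + (k * s - k) + k := by
  have h : k ≤ k * s := Nat.le_mul_of_pos_right k (by omega)
  rw [Nat.mul_add, Nat.mul_one]
  omega

/-- The transformation is monotone on the positive sample values, hence commutes with order
statistics, and `log δ` cancels in the difference. -/
lemma mul_logRatio_eq (hα : 0 < α) (hδ : 0 < δ) (hs : 2 ≤ s) (hk : 1 ≤ k)
    (x : Fin (k * (s + 1) - 1) → ℝ) (hx : ∀ i, δ ≤ x i) :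
    α * logRatio k s x = orderStat (fun i => α * Real.log (x i / δ)) (k * s) -
      orderStat (fun i => α * Real.log (x i / δ)) k := by
  obtain ⟨h1, h2, -⟩ := index_bounds hs hk
  have hmono : MonotoneOn (fun y => α * Real.log (y / δ)) (Set.range x) := by
    rintro _ ⟨i, rfl⟩ _ ⟨j, rfl⟩ hij
    have := hδ.trans_le (hx i)
    simp only
    gcongr
  have hpos (i : ℕ) (hi : 1 ≤ i ∧ i ≤ k * (s + 1) - 1) : 0 < orderStat x i := by
    obtain ⟨j, hj⟩ := orderStat_mem_range x hi
    exact hj ▸ hδ.trans_le (hx j)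
  have hI1 : 1 ≤ k ∧ k ≤ k * (s + 1) - 1 := by omega
  have hI2 : 1 ≤ k * s ∧ k * s ≤ k * (s + 1) - 1 := by omega
  have e1 := orderStat_comp_of_monotoneOn x hmono hI1
  have e2 := orderStat_comp_of_monotoneOn x hmono hI2
  simp only [Function.comp_def] at e1 e2
  have p1 := hpos _ hI1
  have p2 := hpos _ hI2
  rw [e1, e2, logRatio, Real.log_div p2.ne' p1.ne', Real.log_div p2.ne' hδ.ne',
    Real.log_div p1.ne' hδ.ne']
  ring

lemma logRatio_nonneg (hδ : 0 < δ) (hs : 2 ≤ s) (hk : 1 ≤ k)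
    (x : Fin (k * (s + 1) - 1) → ℝ) (hx : ∀ i, δ ≤ x i) : 0 ≤ logRatio k s x := by
  obtain ⟨h1, h2, -⟩ := index_bounds hs hk
  obtain ⟨j, hj⟩ := orderStat_mem_range x (i := k) ⟨hk, by omega⟩
  refine Real.log_nonneg ((one_le_div (hj ▸ hδ.trans_le (hx j))).2 ?_)
  exact orderStat_le_orderStat x hk h1 h2

@[fun_prop]
lemma measurable_logRatio (k s : ℕ) : Measurable (logRatio k s) := by
  unfold logRatio
  fun_prop

variable {Ω : Type*} [MeasurableSpace Ω] {P : Measure Ω}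

lemma ae_le_of_hasLaw_pareto {ι : Type*} [Finite ι] {X : ι → Ω → ℝ}
    (hlaw : ∀ i, HasLaw (X i) (paretoMeasure δ α) P) : ∀ᵐ ω ∂P, ∀ i, δ ≤ X i ω := by
  refine eventually_all.2 fun i => ?_
  have h := ae_le_paretoMeasure α δ
  rw [← (hlaw i).map_eq] at h
  exact ae_of_ae_map (hlaw i).aemeasurable h

/-- The characteristic function of the scaled log-ratio of two order statistics of a Pareto
sample. -/
lemma charFun_map_mul_logRatio [IsProbabilityMeasure P]
    (hα : 0 < α) (hδ : 0 < δ) (hs : 2 ≤ s) (hk : 1 ≤ k)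
    {X : Fin (k * (s + 1) - 1) → Ω → ℝ} (hlaw : ∀ i, HasLaw (X i) (paretoMeasure δ α) P)
    (hindep : iIndepFun X P) (t : ℝ) :
    charFun (P.map fun ω => α * logRatio k s (fun i => X i ω)) t =
      ∏ j ∈ Finset.range (k * s - k), (1 - Complex.I * t / (k + j))⁻¹ := by
  obtain ⟨h1, h2, h3⟩ := index_bounds hs hk
  set Y : Fin (k * (s + 1) - 1) → Ω → ℝ := fun i ω => α * Real.log (X i ω / δ) with hY
  have hg : Measurable fun x => α * Real.log (x / δ) := by fun_prop
  have hYm (i) : AEMeasurable (Y i) P := hg.comp_aemeasurable (hlaw i).aemeasurable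
  have hYlaw (i) : P.map (Y i) = expMeasure 1 := by
    rw [← map_log_paretoMeasure hα hδ, ← (hlaw i).map_eq,
      AEMeasurable.map_map_of_aemeasurable hg.aemeasurable (hlaw i).aemeasurable]
    rfl
  have hYindep : iIndepFun Y P := hindep.comp (fun _ x => α * Real.log (x / δ)) fun _ => hg
  have hYpi : P.map (fun ω i => Y i ω) = Measure.pi fun _ => expMeasure 1 := by
    rw [(iIndepFun_iff_map_fun_eq_pi_map hYm).1 hYindep]
    simp_rw [hYlaw]
  have hae : (fun ω => α * logRatio k s (fun i => X i ω)) =ᵐ[P]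
      (fun y => orderStat y (k * s) - orderStat y k) ∘ fun ω i => Y i ω := by
    filter_upwards [ae_le_of_hasLaw_pareto hlaw] with ω hω
    exact mul_logRatio_eq hα hδ hs hk _ hω
  rw [Measure.map_congr hae, ← AEMeasurable.map_map_of_aemeasurable (by fun_prop)
    (aemeasurable_pi_lambda _ hYm), hYpi,
    charFun_map_orderStat_sub_orderStat h3 (by omega : k * s = k * s - k + k)]
  refine Finset.prod_congr rfl fun j _ => ?_
  rw [Nat.cast_sub hk]
  push_cast
  ring_nf

lemma charFun_map_mul_sub {Y : Ω → ℝ} (hY : AEMeasurable Y P) (c d t : ℝ) :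
    charFun (P.map fun ω => c * (Y ω - d)) t =
      Complex.exp (-(Complex.I * (c * t : ℝ) * d)) * charFun (P.map Y) (c * t) := by
  rw [charFun_apply_real, charFun_apply_real, integral_map (by fun_prop) (by fun_prop),
    integral_map (by fun_prop) (by fun_prop), ← integral_const_mul]
  refine integral_congr_ae (ae_of_all _ fun ω => ?_)
  simp only
  rw [← Complex.exp_add]
  congr 1
  push_cast
  ring

end Sample

/-! ### Asymptotic normality and coverage -/

section Limit

variable {α δ : ℝ} {s : ℕ} {Ω : ℕ → Type*} [∀ k, MeasurableSpace (Ω k)]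
  {P : (k : ℕ) → Measure (Ω k)}
  {X : (k : ℕ) → Fin (k * (s + 1) - 1) → Ω k → ℝ}

lemma aemeasurable_logRatio (hlaw : ∀ k i, HasLaw (X k i) (paretoMeasure δ α) (P k)) (k : ℕ) :
    AEMeasurable (fun ω => logRatio k s (fun i => X k i ω)) (P k) :=
  (measurable_logRatio k s).comp_aemeasurable
    (aemeasurable_pi_lambda _ fun i => (hlaw k i).aemeasurable)

/-- Asymptotic normality of the centred and scaled log-ratio of order statistics. -/
theorem tendstoInDistribution_logRatio [∀ k, IsProbabilityMeasure (P k)]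
    (hα : 0 < α) (hδ : 0 < δ) (hs : 2 ≤ s)
    (hlaw : ∀ k i, HasLaw (X k i) (paretoMeasure δ α) (P k))
    (hindep : ∀ k, iIndepFun (X k) (P k)) (c : ℝ) :
    TendstoInDistribution
      (fun (k : ℕ) ω => c * √((k : ℝ) * (s + 1) - 1) *
        (α * logRatio k s (fun i => X k i ω) - Real.log s))
      atTop id P (gaussianReal 0 (c ^ 2 * (((s : ℝ) ^ 2 - 1) / s)).toNNReal) := by
  have hL := aemeasurable_logRatio hlaw
  have hvar : 0 ≤ c ^ 2 * (((s : ℝ) ^ 2 - 1) / s) := by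
    have : (2 : ℝ) ≤ s := by exact_mod_cast hs
    have : 0 ≤ (s : ℝ) ^ 2 - 1 := by nlinarith
    positivity
  refine ⟨fun k => by have := hL k; fun_prop, aemeasurable_id, ?_⟩
  refine ProbabilityMeasure.tendsto_iff_tendsto_charFun.2 fun t => ?_
  simp only [ProbabilityMeasure.coe_mk, Measure.map_id, charFun_gaussianReal,
    Real.coe_toNNReal _ hvar]
  have hlim := tendsto_exp_mul_prod hs (c * t)
  have hval : Complex.exp (-(((s : ℝ) ^ 2 - 1) / s * (c * t) ^ 2 / 2 : ℝ)) =
      Complex.exp (t * (0 : ℝ) * Complex.I -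
        ((c ^ 2 * (((s : ℝ) ^ 2 - 1) / s) : ℝ) : ℂ) * t ^ 2 / 2) := by
    congr 1
    push_cast
    ring
  rw [hval] at hlim
  refine hlim.congr' ?_
  filter_upwards [eventually_ge_atTop 1] with k hk
  have hLk := hL k
  rw [charFun_map_mul_sub (Y := fun ω => α * logRatio k s (fun i => X k i ω)) (by fun_prop),
    charFun_map_mul_logRatio hα hδ hs hk (hlaw k) (hindep k)]
  have : c * √((k : ℝ) * (s + 1) - 1) * t = √((k : ℝ) * (s + 1) - 1) * (c * t) := by ring
  rw [this]

lemma harmonicDiff_pos (hs : 2 ≤ s) {k : ℕ} (hk : 1 ≤ k) : 0 < harmonicDiff k s := by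
  have h : k < k * s := lt_mul_of_one_lt_right hk (by omega)
  have hlt : harmonic (k - 1) < harmonic (k * s - 1) := by
    unfold harmonic
    refine Finset.sum_lt_sum_of_subset (Finset.range_subset_range.2 (by omega))
      (i := k - 1) (by simp; omega) (by simp) (by positivity) fun _ _ _ => by positivity
  exact sub_pos.2 (by exact_mod_cast hlt)

/-- Membership in the confidence interval, expressed through the standardized log-ratio. -/
lemma mem_confInterval_iff (hα : 0 < α) (hs : 2 ≤ s) {k : ℕ} (hk : 1 ≤ k) {a : ℝ}
    (hlarge : normalQuantile (1 - a / 2) * √(((s : ℝ) ^ 2 - 1) / s) <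
      √((k : ℝ) * (s + 1) - 1) * Real.log s)
    {x : Fin (k * (s + 1) - 1) → ℝ} (hx : 0 ≤ logRatio k s x) :
    α ∈ confInterval k s a x ↔
      (√(((s : ℝ) ^ 2 - 1) / s))⁻¹ * √((k : ℝ) * (s + 1) - 1) * (α * logRatio k s x - Real.log s) ∈
        Set.Icc (-normalQuantile (1 - a / 2)) (normalQuantile (1 - a / 2)) := by
  have hs2 : (2 : ℝ) ≤ s := by exact_mod_cast hs
  have hk1 : (1 : ℝ) ≤ k := by exact_mod_cast hk
  have hn : 0 < (k : ℝ) * (s + 1) - 1 := by nlinarith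
  have hv : 0 < ((s : ℝ) ^ 2 - 1) / s := div_pos (by nlinarith) (by linarith)
  have hsplit : √(((s : ℝ) ^ 2 - 1) / (s * (k * (s + 1) - 1))) =
      √(((s : ℝ) ^ 2 - 1) / s) / √((k : ℝ) * (s + 1) - 1) := by
    rw [← div_div, Real.sqrt_div' _ hn.le]
  have hσ : 0 < √(((s : ℝ) ^ 2 - 1) / s) := Real.sqrt_pos.2 hv
  have hr : 0 < √((k : ℝ) * (s + 1) - 1) := Real.sqrt_pos.2 hn
  rw [confInterval, hsplit]
  set z := normalQuantile (1 - a / 2)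
  set σ := √(((s : ℝ) ^ 2 - 1) / s)
  set r := √((k : ℝ) * (s + 1) - 1)
  set L := logRatio k s x
  have e1 : σ⁻¹ * r * (α * L - Real.log s) = (α * L - Real.log s) / (σ / r) := by
    field_simp
  rw [e1, Set.mem_Icc, Set.mem_Icc, le_div_iff₀ (by positivity), div_le_iff₀ (by positivity)]
  -- If the log-ratio is 0, division by zero collapses the interval to `{0}`, which misses `α > 0`;
  -- `hlarge` makes the standardized value fall below `-z`, so both sides fail.
  rcases hx.eq_or_lt with h0 | hpos
  · rw [← h0]
    simp only [div_zero, zero_mul, sub_zero, add_zero, mul_zero, zero_sub]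
    refine ⟨fun h => absurd h.2 (not_le.2 hα), fun h => ?_⟩
    have h1 := h.1
    have h2 : z * (σ / r) < Real.log s := by
      rw [← mul_div_assoc, div_lt_iff₀ hr]
      linarith
    linarith
  · have e2 : Real.log s / L - z / L * (σ / r) = (Real.log s - z * (σ / r)) / L := by ring
    have e3 : Real.log s / L + z / L * (σ / r) = (Real.log s + z * (σ / r)) / L := by ring
    rw [e2, e3, div_le_iff₀ hpos, le_div_iff₀ hpos]
    constructor <;> rintro ⟨h1, h2⟩ <;> constructor <;> linarith

lemma tendsto_sqrt_sampleSize_atTop (s : ℕ) :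
    Tendsto (fun k : ℕ => √((k : ℝ) * (s + 1) - 1)) atTop atTop := by
  refine Real.tendsto_sqrt_atTop.comp (tendsto_atTop_add_const_right _ _ ?_)
  exact tendsto_natCast_atTop_atTop.atTop_mul_const (by positivity)

/-- The confidence intervals have the nominal asymptotic coverage probability. -/
theorem tendsto_confInterval_coverage [∀ k, IsProbabilityMeasure (P k)]
    (hα : 0 < α) (hδ : 0 < δ) (hs : 2 ≤ s)
    (hlaw : ∀ k i, HasLaw (X k i) (paretoMeasure δ α) (P k))
    (hindep : ∀ k, iIndepFun (X k) (P k)) {a : ℝ} (ha0 : 0 < a) (ha1 : a < 1) :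
    Tendsto (fun k => (P k).real {ω | α ∈ confInterval k s a (fun i => X k i ω)})
      atTop (𝓝 (1 - a)) := by
  have hs2 : (2 : ℝ) ≤ s := by exact_mod_cast hs
  have hv : 0 < ((s : ℝ) ^ 2 - 1) / s := div_pos (by nlinarith) (by linarith)
  have hlog : 0 < Real.log s := Real.log_pos (by linarith)
  have hT := tendstoInDistribution_logRatio hα hδ hs hlaw hindep (√(((s : ℝ) ^ 2 - 1) / s))⁻¹
  have hvar : ((√(((s : ℝ) ^ 2 - 1) / s))⁻¹ ^ 2 * (((s : ℝ) ^ 2 - 1) / s)).toNNReal = 1 := by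
    rw [inv_pow, Real.sq_sqrt hv.le, inv_mul_cancel₀ hv.ne', Real.toNNReal_one]
  set z := normalQuantile (1 - a / 2)
  -- Portmanteau applies because the boundary of a convex set is Lebesgue-null, hence Gaussian-null.
  have hconv := ProbabilityMeasure.tendsto_measure_of_null_frontier_of_tendsto' hT.tendsto
    (E := Set.Icc (-z) z) (by
      simp only [ProbabilityMeasure.coe_mk, Measure.map_id, hvar]
      exact gaussianReal_absolutelyContinuous 0 one_ne_zero
        ((convex_Icc (-z) z).addHaar_frontier volume))
  simp only [ProbabilityMeasure.coe_mk, Measure.map_id, hvar] at hconv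
  have hreal := (ENNReal.tendsto_toReal (measure_ne_top _ _)).comp hconv
  rw [← measureReal_def, stdGaussian_Icc_normalQuantile ha0 ha1] at hreal
  refine hreal.congr' ?_
  have hlarge := ((tendsto_sqrt_sampleSize_atTop s).atTop_mul_const hlog).eventually_gt_atTop
    (z * √(((s : ℝ) ^ 2 - 1) / s))
  filter_upwards [hlarge, eventually_ge_atTop 1] with k hk hk1
  rw [Function.comp_apply, ← measureReal_def,
    map_measureReal_apply_of_aemeasurable (hT.forall_aemeasurable k) measurableSet_Icc]
  refine measureReal_congr ?_
  filter_upwards [ae_le_of_hasLaw_pareto (hlaw k)] with ω hω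
  exact propext (mem_confInterval_iff hα hs hk1 hk (logRatio_nonneg hδ hs hk1 _ hω)).symm

end Limit

end ParetoOrder

open MeasureTheory ProbabilityTheory Filter Topology ParetoOrder in
theorem theorem4 {α δ : ℝ} (hα : 0 < α) (hδ : 0 < δ) {s : ℕ} (hs : 2 ≤ s)
    {Ω : ℕ → Type*} [∀ k, MeasurableSpace (Ω k)]
    (P : (k : ℕ) → Measure (Ω k)) [∀ k, IsProbabilityMeasure (P k)]
    (X : (k : ℕ) → Fin (k * (s + 1) - 1) → Ω k → ℝ)
    (hlaw : ∀ k i, HasLaw (X k i) (paretoMeasure δ α) (P k))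
    (hindep : ∀ k, iIndepFun (X k) (P k)) :
    TendstoInDistribution
      (fun (k : ℕ) ω => √((k : ℝ) * (s + 1) - 1) *
        (logRatio k s (fun i => X k i ω) - 1 / α * Real.log s))
      atTop id P (gaussianReal 0 (((s : ℝ) ^ 2 - 1) / (s * α ^ 2)).toNNReal) ∧
    TendstoInDistribution
      (fun (k : ℕ) ω => √((k : ℝ) * (s + 1) - 1) * harmonicDiff k s *
        (α * Q k s (fun i => X k i ω) - Real.log s / harmonicDiff k s))
      atTop id P (gaussianReal 0 (((s : ℝ) ^ 2 - 1) / s).toNNReal) ∧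
    TendstoInDistribution
      (fun (k : ℕ) ω => √((k : ℝ) * (s + 1) - 1) * (α * QStar k s (fun i => X k i ω) - 1))
      atTop id P (gaussianReal 0 (((s : ℝ) ^ 2 - 1) / (s * Real.log s ^ 2)).toNNReal) ∧
    ∀ a : ℝ, 0 < a → a < 1 →
      Tendsto (fun k => (P k).real {ω | α ∈ confInterval k s a (fun i => X k i ω)})
        atTop (𝓝 (1 - a)) := by
  have hs2 : (2 : ℝ) ≤ s := by exact_mod_cast hs
  have hlog : 0 < Real.log s := Real.log_pos (by linarith)
  have hT := tendstoInDistribution_logRatio hα hδ hs hlaw hindep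
  refine ⟨?_, ?_, ?_, fun a ha0 ha1 => tendsto_confInterval_coverage hα hδ hs hlaw hindep ha0 ha1⟩
  · have hvar : ((s : ℝ) ^ 2 - 1) / (s * α ^ 2) = (1 / α) ^ 2 * (((s : ℝ) ^ 2 - 1) / s) := by
      field_simp
    rw [hvar]
    refine (hT (1 / α)).congr (fun k => ae_of_all _ fun ω => ?_) (ae_of_all _ fun _ => rfl)
    simp only
    field_simp
  · have hvar : ((s : ℝ) ^ 2 - 1) / s = 1 ^ 2 * (((s : ℝ) ^ 2 - 1) / s) := by ring
    rw [hvar]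
    refine (hT 1).congr (fun k => ae_of_all _ fun ω => ?_) (ae_of_all _ fun _ => rfl)
    -- At `k = 0` the harmonic difference is 0 and cannot be cancelled, but `√(-1) = 0` makes both
    -- sides vanish.
    rcases Nat.eq_zero_or_pos k with rfl | hk
    · simp [Real.sqrt_eq_zero_of_nonpos]
    · have := harmonicDiff_pos hs hk
      simp only [Q]
      field_simp
  · have hvar : ((s : ℝ) ^ 2 - 1) / (s * Real.log s ^ 2) =
        (1 / Real.log s) ^ 2 * (((s : ℝ) ^ 2 - 1) / s) := by
      field_simp
    rw [hvar]
    refine (hT (1 / Real.log s)).congr (fun k => ae_of_all _ fun ω => ?_) (ae_of_all _ fun _ => rfl)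
    simp only [QStar]
    field_simp
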